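/- **Setting.** Let $\mathbb K\in\{\mathbb R,\mathbb C\}$, let $\mathcal S$ be a topological state space with its Borel $\sigma$-algebra and $\mathcal A$ a finite non-empty action set. For clients $i=1,\dots,N$ let $\Phi_i:\mathcal S\to\mathbb K^{D_i}$ ($D_i\ge 1$) be measurable encoders with $\|\Phi_i(s)\|_2\le 1$, and let $\pi_i\ge 0$, $\sum_i\pi_i=1$. For $W=[w_a]_{a\in\mathcal A}\in\mathbb K^{D_i\times|\mathcal A|}$ put $Q_i(s,a;W)=\Re\langle\Phi_i(s),w_a\rangle$. Regard $\mathbb K^{D_i}$ as a real vector space, of dimension $d_i=D_i\dim_{\mathbb R}\mathbb K$ (so $d_i=D_i$ for $\mathbb K=\mathbb R$). Assume: 1. *(Common RKHS)* There is a separable RKHS $\mathcal H$ of real functions on $\mathcal S$ with continuous kernel $\kappa$, $\kappa(s,s)\le 1$, that contains every function $\Re\langle\Phi_i(\cdot),w\rangle$, $w\in\mathbb K^{D_i}$; let $\mathcal F_i\subset\mathcal H$ be the subspace of these functions. The optimal action-value function $Q^*$ of a discounted MDP on $(\mathcal S,\mathcal A)$ (the bounded solution of the Bellman optimality equation) satisfies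 $Q^*(\cdot,a)\in\mathcal H$ and $\|Q^*(\cdot,a)\|_{\mathcal H}\le B$ for all $a$. 2. *(Feature covariance)* $\mathbb E_{s\sim\nu_i}[\Phi_i(s)\Phi_i(s)^{\mathrm H}]\succ0$ for the local state distribution $\nu_i$ of each client. 3. *(Anchors)* $s_1,s_2,\dots$ are i.i.d. with law $\nu_{\mathrm{ref}}$, and $\nu_{\mathrm{ref}}\ll\nu_i$ for all $i$. Let $\hat W_i$ be oracle parameters, $\hat Q_i=Q_i(\cdot,\cdot;\hat W_i)$, in one of the following two senses (the same for all clients; the result holds for either): $\hat Q_i$ minimizes $\mathbb E_{(s,a)\sim\mu}(Q_i(s,a;W)-Q^*(s,a))^2$ over $W$, for a given probability measure $\mu$ on $\mathcal S\times\mathcal A$; or $\hat Q_i(\cdot,a)$ is the $\mathcal H$-orthogonal projection of $Q^*(\cdot,a)$ onto $\mathcal F_i$ for every $a$. Let $\varepsilon_i^{\mathrm{rep}}=\max_a\|Q^*(\cdot,a)-\hat Q_i(\cdot,a)\|_{\mathcal H}$, let $\theta_{ij}$ be the largest principal angle between $\mathcal F_i$ and $\mathcal F_j$ in $\mathcal H$,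 and $$\bar h_i=\sum_{j\ne i}\pi_j\bigl(2B\sin\theta_{ij}+\varepsilon_i^{\mathrm{rep}}+\varepsilon_j^{\mathrm{rep}}\bigr).$$ For an anchor set $x=(x_1,\dots,x_m)\in\mathcal S^m$ let $G_i\in\mathbb R^{m\times m}$ have the entries $\Re\langle\Phi_i(x_\ell),\Phi_i(x_k)\rangle$, and let $\gamma_i$ be its smallest positive eigenvalue. The teacher is $Q^{\mathrm{glob}}_{\mathrm{ref}}(x_\ell,a)=\sum_j\pi_j\hat Q_j(x_\ell,a)$; for $\lambda\ge0$ let $W_i^{\mathrm{glob}}(\lambda)$ be a minimizer of $\sum_{\ell,a}(Q_i(x_\ell,a;W)-Q^{\mathrm{glob}}_{\mathrm{ref}}(x_\ell,a))^2+\lambda\|W\|_F^2$. The federation gap is $\Delta_i(s,a)=\Delta_i(s,a;\lambda)=\hat Q_i(s,a)-Q_i(s,a;W_i^{\mathrm{glob}}(\lambda))$. **Corollary (heterogeneity-dominated regime).** Fix a client $i$. (a) For every anchor set with $m\ge d_i$ and $\operatorname{rank}G_i=d_i$ we have $\gamma_i>0$, and for all $\lambda\ge0$ and all $(s,a)$ $$|\Delta_i(s,a;\lambda)|\le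 \bar h_i+\frac{\sqrt m}{\sqrt{\gamma_i+\lambda}}\,\bar h_i+\frac{\lambda}{\gamma_i+\lambda}\|\hat W_i\|_F .$$ As $\lambda\to0^+$ the last term tends to $0$, the limit of $\Delta_i(s,a;\lambda)$ exists, and $$\Bigl|\lim_{\lambda\to0^+}\Delta_i(s,a;\lambda)\Bigr|\le\Bigl(1+\frac{\sqrt m}{\sqrt{\gamma_i}}\Bigr)\bar h_i .$$ (b) Let $g_i=\min_{\|v\|=1}\mathbb E_{s\sim\nu_{\mathrm{ref}}}[(\Re\langle\Phi_i(s),v\rangle)^2]$, which depends only on $\Phi_i$ and $\nu_{\mathrm{ref}}$, and for every $m$ take the anchor set $(s_1,\dots,s_m)$. Almost surely, if $\operatorname{rank}G_i=d_i$ for some $m\ge d_i$, then $g_i>0$, and as $m\to\infty$ $$\frac{\gamma_i}{m}\to g_i,\qquad \frac{\sqrt m}{\sqrt{\gamma_i+\lambda}}\to\frac1{\sqrt{g_i}}\quad\text{for every }\lambda\ge0 ,$$ and for every constant $C>1+1/\sqrt{g_i}$, for all sufficiently large $m$ and all $(s,a)$, $$\Bigl|\lim_{\lambda\to0^+}\Delta_i(s,a;\lambda)\Bigr|\le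 C\,\bar h_i .$$ That is, the gap is $O(\bar h_i)$ with a constant independent of $m$. -/

import Mathlib

open MeasureTheory ProbabilityTheory Filter Topology

namespace FedQHD

noncomputable section

/-- The linear read-out `Re ⟨Φ(s), w⟩ = Re (Φ(s)ᴴ w)`. -/
def readout {S 𝕜 : Type*} [RCLike 𝕜] {D : ℕ} (Φ : S → EuclideanSpace 𝕜 (Fin D))
    (w : EuclideanSpace 𝕜 (Fin D)) (s : S) : ℝ :=
  RCLike.re (inner 𝕜 (Φ s) w)

/-- The Frobenius norm of the parameter matrix whose columns are `W a`. -/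
def frobNorm {A 𝕜 : Type*} [Fintype A] [RCLike 𝕜] {D : ℕ}
    (W : A → EuclideanSpace 𝕜 (Fin D)) : ℝ :=
  √(∑ a, ‖W a‖ ^ 2)

/-- A discounted Markov decision process with state space `S` and action set `A`. -/
structure MDP (S A : Type*) [MeasurableSpace S] where
  /-- the transition kernel under each action -/
  P : A → Kernel S S
  markov : ∀ a, IsMarkovKernel (P a)
  /-- the reward -/
  r : S → A → ℝ
  /-- the discount factor -/
  disc : ℝ
  disc_pos : 0 < disc
  disc_lt_one : disc < 1

/-- The Bellman optimality equation.  The theorem uses it only for functions with continuous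
bounded sections, among which it has at most one solution: the optimal action-value function. -/
def MDP.IsOptimalQ {S A : Type*} [MeasurableSpace S] (M : MDP S A) (Q : S → A → ℝ) : Prop :=
  ∀ s a, Q s a = M.r s a + M.disc * ∫ s', (⨆ a', Q s' a') ∂(M.P a s)

/-- The uncentred feature covariance `E_{s ∼ ν} [Φ(s) Φ(s)ᴴ]`. -/
def featureCov {S 𝕜 : Type*} [MeasurableSpace S] [RCLike 𝕜] {D : ℕ}
    (Φ : S → EuclideanSpace 𝕜 (Fin D)) (ν : Measure S) : Matrix (Fin D) (Fin D) 𝕜 :=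
  Matrix.of fun k l => ∫ s, Φ s k * star (Φ s l) ∂ν

/-- The scalar reproducing kernel of a real RKHS of real-valued functions. -/
def scalarKernel {S : Type*} (H : Type*) [NormedAddCommGroup H] [InnerProductSpace ℝ H]
    [CompleteSpace H] [RKHS ℝ H S ℝ] (s t : S) : ℝ :=
  RKHS.kernel H s t 1

/-- `‖(I - Π_U) Π_V‖`, with `Π` the orthogonal projections. -/
def projGap {H : Type*} [NormedAddCommGroup H] [InnerProductSpace ℝ H]
    (U V : Submodule ℝ H) [U.HasOrthogonalProjection] [V.HasOrthogonalProjection] : ℝ :=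
  ‖(ContinuousLinearMap.id ℝ H - U.starProjection) ∘L V.starProjection‖

/-- The largest principal angle between two finite-dimensional subspaces.  If `dim V ≤ dim U` its
sine is `‖(I - Π_U) Π_V‖`; the minimum below selects this number whichever dimension is larger
(for distinct dimensions the other number is `1`, for equal dimensions the two agree). -/
def principalAngle {H : Type*} [NormedAddCommGroup H] [InnerProductSpace ℝ H]
    (U V : Submodule ℝ H) [U.HasOrthogonalProjection] [V.HasOrthogonalProjection] : ℝ :=
  Real.arcsin (min (projGap U V) (projGap V U))

/-- The columns of `W` are parameters of a best approximation of `Q` in the `L²(μ)` sense within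
the function class of the encoder `Φ`. -/
def IsL2Oracle {S A 𝕜 : Type*} [MeasurableSpace S] [MeasurableSpace A] [RCLike 𝕜] {D : ℕ}
    (Φ : S → EuclideanSpace 𝕜 (Fin D)) (μ : Measure (S × A)) (Q : S → A → ℝ)
    (W : A → EuclideanSpace 𝕜 (Fin D)) : Prop :=
  ∀ W' : A → EuclideanSpace 𝕜 (Fin D),
    ∫ p, (readout Φ (W p.2) p.1 - Q p.1 p.2) ^ 2 ∂μ
      ≤ ∫ p, (readout Φ (W' p.2) p.1 - Q p.1 p.2) ^ 2 ∂μ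

/-- The columns of `W` are parameters of the orthogonal projections, in the common RKHS, of the
functions `Q a` onto the (embedded) function class of the encoder. -/
def IsRKHSOracle {A 𝕜 H : Type*} [RCLike 𝕜] [NormedAddCommGroup H] [InnerProductSpace ℝ H]
    {D : ℕ} (J : EuclideanSpace 𝕜 (Fin D) →ₗ[ℝ] H) (Q : A → H)
    (W : A → EuclideanSpace 𝕜 (Fin D)) : Prop :=
  ∀ a, J (W a) = (LinearMap.range J).starProjection (Q a)

/-- The representation error `max_a ‖Q(·,a) - Q̂(·,a)‖` in the RKHS norm, where `Q̂` is the oracle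
with parameters `W`. -/
def repError {A 𝕜 H : Type*} [RCLike 𝕜] [NormedAddCommGroup H] [InnerProductSpace ℝ H]
    {D : ℕ} (J : EuclideanSpace 𝕜 (Fin D) →ₗ[ℝ] H) (Q : A → H)
    (W : A → EuclideanSpace 𝕜 (Fin D)) : ℝ :=
  ⨆ a, ‖Q a - J (W a)‖

/-- The encoder heterogeneity
`h̄ᵢ = ∑_{j ≠ i} πⱼ (2 B sin θᵢⱼ + εᵢ + εⱼ)`. -/
def heterogeneity {A 𝕜 H : Type*} [RCLike 𝕜] [NormedAddCommGroup H] [InnerProductSpace ℝ H]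
    {N : ℕ} {D : Fin N → ℕ} (J : ∀ i, EuclideanSpace 𝕜 (Fin (D i)) →ₗ[ℝ] H) (Q : A → H)
    (W : ∀ i, A → EuclideanSpace 𝕜 (Fin (D i))) (weight : Fin N → ℝ) (B : ℝ) (i : Fin N) : ℝ :=
  ∑ j ∈ Finset.univ.erase i, weight j *
    (2 * B * Real.sin (principalAngle (LinearMap.range (J i)) (LinearMap.range (J j)))
      + repError (J i) Q (W i) + repError (J j) Q (W j))

/-- The teacher on the anchors `x`: the weighted average of the clients' predictors with
parameters `W`. -/
def teacher {S A 𝕜 : Type*} [RCLike 𝕜] {N m : ℕ} {D : Fin N → ℕ}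
    (Φ : ∀ i, S → EuclideanSpace 𝕜 (Fin (D i))) (W : ∀ i, A → EuclideanSpace 𝕜 (Fin (D i)))
    (weight : Fin N → ℝ) (x : Fin m → S) (l : Fin m) (a : A) : ℝ :=
  ∑ j, weight j * readout (Φ j) (W j a) (x l)

/-- The ridge objective for fitting the anchor targets `T` with the encoder `Φ`. -/
def ridgeObjective {S A 𝕜 : Type*} [Fintype A] [RCLike 𝕜] {D m : ℕ}
    (Φ : S → EuclideanSpace 𝕜 (Fin D)) (x : Fin m → S) (T : Fin m → A → ℝ) (lam : ℝ)
    (W : A → EuclideanSpace 𝕜 (Fin D)) : ℝ :=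
  ∑ l, ∑ a, (readout Φ (W a) (x l) - T l a) ^ 2 + lam * frobNorm W ^ 2

/-- `W` is a compiled parameter matrix: a minimiser of the ridge objective. -/
def IsCompiled {S A 𝕜 : Type*} [Fintype A] [RCLike 𝕜] {D m : ℕ}
    (Φ : S → EuclideanSpace 𝕜 (Fin D)) (x : Fin m → S) (T : Fin m → A → ℝ) (lam : ℝ)
    (W : A → EuclideanSpace 𝕜 (Fin D)) : Prop :=
  ∀ W' : A → EuclideanSpace 𝕜 (Fin D),
    ridgeObjective Φ x T lam W ≤ ridgeObjective Φ x T lam W'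

/-- The anchor Gram matrix, with entries `Re ⟨Φ(x l), Φ(x k)⟩`.  It equals `X Xᵀ`, where `X` is the
real matrix of the map `w ↦ (Re ⟨Φ(x l), w⟩)_l` from the real vector space `𝕜^D` to `ℝ^m`. -/
def anchorGram {S 𝕜 : Type*} [RCLike 𝕜] {D m : ℕ}
    (Φ : S → EuclideanSpace 𝕜 (Fin D)) (x : Fin m → S) : Matrix (Fin m) (Fin m) ℝ :=
  Matrix.of fun l k => RCLike.re (inner 𝕜 (Φ (x l)) (Φ (x k)))

/-- The smallest positive eigenvalue of a real square matrix. -/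
def minPosEigenvalue {m : ℕ} (G : Matrix (Fin m) (Fin m) ℝ) : ℝ :=
  sInf {t : ℝ | 0 < t ∧ Module.End.HasEigenvalue (Matrix.toLin' G) t}

/-- The number `γ`: the smallest positive eigenvalue of the anchor Gram matrix. -/
def anchorGamma {S 𝕜 : Type*} [RCLike 𝕜] {D m : ℕ}
    (Φ : S → EuclideanSpace 𝕜 (Fin D)) (x : Fin m → S) : ℝ :=
  minPosEigenvalue (anchorGram Φ x)

/-- `min_{‖v‖ = 1} E_{s ∼ ν} [(Re ⟨Φ(s), v⟩)²]`, a number that depends only on the encoder and on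
the distribution `ν`. -/
def populationGamma {S 𝕜 : Type*} [MeasurableSpace S] [RCLike 𝕜] {D : ℕ}
    (Φ : S → EuclideanSpace 𝕜 (Fin D)) (ν : Measure S) : ℝ :=
  ⨅ v : Metric.sphere (0 : EuclideanSpace 𝕜 (Fin D)) 1, ∫ s, (readout Φ v s) ^ 2 ∂ν

/-- The federation gap at `(s, a)`: oracle with parameters `What` minus compiled predictor with
parameters `W`. -/
def fedGap {S A 𝕜 : Type*} [RCLike 𝕜] {D : ℕ} (Φ : S → EuclideanSpace 𝕜 (Fin D))
    (What W : A → EuclideanSpace 𝕜 (Fin D)) (s : S) (a : A) : ℝ :=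
  readout Φ (What a) s - readout Φ (W a) s

end

end FedQHD

open scoped ComplexOrder

/-! Both parts are statements about the real vector space `𝕜^D`, on which a read-out is the real
inner product with the feature. The anchor features `φ l` define `X v = (⟪φ l, v⟫)_l`, and the Gram
matrix is `X Xᵀ`. At full rank `X` is injective. Since `X Xᵀ` and `Xᵀ X` share their positive
eigenvalues, `γ` is then the minimum of the energy `‖X v‖²` on the unit sphere
(`exists_minPosEigenvalue_eq`), hence a lower frame bound.

For (a), the triangle inequality through `Q*` bounds `‖Q̂ᵢ - Q̂ⱼ‖` by the two representation errors,
and a kernel with `κ(s,s) ≤ 1` makes the RKHS norm dominate pointwise values. So teacher and oracle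
differ by at most `h̄ᵢ` at each anchor, and the oracle has residual at most `√m h̄ᵢ` in the ridge
problem. Coercivity of the normal equations (`IsRidgeSolution.norm_sub_le`) turns this residual into
a distance between parameters, which bounds the gap because features have norm at most `1`. As `λ →
0⁺` the ridge solutions converge to the least squares solution, and the bound passes to the limit.

For (b), `‖X v‖² / m` is an empirical second moment. A quadratic form has finitely many
coefficients, so the strong law gives almost sure convergence uniformly on the sphere
(`ae_uniform_secondMoment`), and minima converge with it. If the limit `g` were `0`, some fixed
direction would almost surely be orthogonal to every anchor feature, and full rank could never
occur. -/

namespace FedQHD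

/-! ### Frames in a finite-dimensional real inner product space -/

section Frame

variable {E : Type*} [NormedAddCommGroup E] [InnerProductSpace ℝ E] {m : ℕ}

/-- A quadratic polynomial without constant term that is nonnegative has no linear term. -/
theorem linear_coeff_eq_zero {b c : ℝ} (h : ∀ t : ℝ, 0 ≤ 2 * t * b + t ^ 2 * c) : b = 0 := by
  have hc : 0 < |c| + 1 := by positivity
  -- The minimiser would be `-b / c`; replacing `c` by `|c| + 1` keeps the denominator positive
  -- whatever the sign of `c`, and the value at this point is still negative unless `b = 0`.
  have h1 := h (-b / (|c| + 1))
  have h2 : 2 * (-b / (|c| + 1)) * b + (-b / (|c| + 1)) ^ 2 * c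
      = -(b ^ 2 * (2 * (|c| + 1) - c)) / (|c| + 1) ^ 2 := by
    field_simp
    ring
  rw [h2] at h1
  have h3 : b ^ 2 * (2 * (|c| + 1) - c) ≤ 0 := by
    by_contra! h4
    exact absurd h1 (not_le.2 (div_neg_of_neg_of_pos (by linarith) (by positivity)))
  have h4 := le_abs_self c
  have h5 : 0 < 2 * (|c| + 1) - c := by linarith
  have h6 : b ^ 2 ≤ 0 := by
    by_contra! h7
    exact absurd h3 (not_le.2 (mul_pos h7 h5))
  exact pow_eq_zero_iff two_ne_zero |>.1 (le_antisymm h6 (sq_nonneg b))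

/-- The energy `∑ₗ ⟪φₗ, v⟫²` of a vector in a finite family. -/
def frameEnergy (φ : Fin m → E) (v : E) : ℝ := ∑ l, (inner ℝ (φ l) v) ^ 2

/-- The family `φ` separates the vectors of `E`. -/
def Separates (φ : Fin m → E) : Prop := ∀ v, (∀ l, inner ℝ (φ l) v = 0) → v = 0

theorem Separates.mono {y : ℕ → E} {n : ℕ} (hmn : m ≤ n) (h : Separates fun l : Fin m => y l) :
    Separates fun l : Fin n => y l :=
  fun v hv => h v fun l => hv (Fin.castLE hmn l)

theorem frameEnergy_nonneg (φ : Fin m → E) (v : E) : 0 ≤ frameEnergy φ v :=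
  Finset.sum_nonneg fun _ _ => sq_nonneg _

theorem frameEnergy_smul (φ : Fin m → E) (c : ℝ) (v : E) :
    frameEnergy φ (c • v) = c ^ 2 * frameEnergy φ v := by
  simp only [frameEnergy, inner_smul_right, mul_pow, Finset.mul_sum]

theorem frameEnergy_add_smul (φ : Fin m → E) (t : ℝ) (v w : E) :
    frameEnergy φ (v + t • w) = frameEnergy φ v
      + 2 * t * ∑ l, inner ℝ (φ l) v * inner ℝ (φ l) w + t ^ 2 * frameEnergy φ w := by
  simp only [frameEnergy, inner_add_right, inner_smul_right, Finset.mul_sum,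
    ← Finset.sum_add_distrib]
  exact Finset.sum_congr rfl fun l _ => by ring

theorem norm_add_smul_sq (t : ℝ) (v w : E) :
    ‖v + t • w‖ ^ 2 = ‖v‖ ^ 2 + 2 * t * inner ℝ v w + t ^ 2 * ‖w‖ ^ 2 := by
  rw [norm_add_sq_real, inner_smul_right, norm_smul, mul_pow, Real.norm_eq_abs, sq_abs]
  ring

theorem continuous_frameEnergy (φ : Fin m → E) : Continuous (frameEnergy φ) := by
  unfold frameEnergy
  fun_prop

theorem frameEnergy_pos {φ : Fin m → E} (h : Separates φ) {v : E} (hv : v ≠ 0) :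
    0 < frameEnergy φ v := by
  refine lt_of_le_of_ne (frameEnergy_nonneg φ v) fun h0 => hv (h v fun l => ?_)
  have := (Finset.sum_eq_zero_iff_of_nonneg fun l _ => sq_nonneg (inner ℝ (φ l) v)).1 h0.symm l
    (Finset.mem_univ l)
  exact pow_eq_zero_iff two_ne_zero |>.1 this

/-- This is the factorisation `G = X Xᵀ`, which carries eigenvectors between `ℝ^m` and `E`. -/
theorem gram_mulVec (φ : Fin m → E) (u : Fin m → ℝ) (l : Fin m) :
    (Matrix.of fun l k => inner ℝ (φ l) (φ k)).mulVec u l = inner ℝ (φ l) (∑ k, u k • φ k) := by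
  simp only [Matrix.mulVec, dotProduct, Matrix.of_apply, inner_sum, inner_smul_right]
  exact Finset.sum_congr rfl fun k _ => mul_comm _ _

theorem mul_norm_sq_le_of_sphere {f : E → ℝ} (hf : ∀ (c : ℝ) v, f (c • v) = c ^ 2 * f v) {t : ℝ}
    (h : ∀ v ∈ Metric.sphere (0 : E) 1, t ≤ f v) (v : E) : t * ‖v‖ ^ 2 ≤ f v := by
  rcases eq_or_ne v 0 with rfl | hv
  · have := hf 0 0
    simp at this
    simp [this]
  · have hn : ‖v‖ ≠ 0 := norm_ne_zero_iff.2 hv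
    have h1 := h (‖v‖⁻¹ • v) (by simp [norm_smul, hn])
    rw [hf] at h1
    calc t * ‖v‖ ^ 2 ≤ (‖v‖⁻¹ ^ 2 * f v) * ‖v‖ ^ 2 := by gcongr
      _ = f v := by field_simp

variable [FiniteDimensional ℝ E]

/-- A family whose Gram matrix has rank `dim E` separates the vectors of `E`. -/
theorem separates_of_rank_gram {φ : Fin m → E}
    (h : (Matrix.of fun l k => inner ℝ (φ l) (φ k)).rank = Module.finrank ℝ E) :
    Separates φ := by
  let X : E →ₗ[ℝ] (Fin m → ℝ) := LinearMap.pi fun l => (innerSL ℝ (φ l)).toLinearMap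
  have hX : ∀ v l, X v l = inner ℝ (φ l) v := fun v l => by simp [X]
  -- Since `G = X Xᵀ`, the rank of `G` is at most that of `X`; rank-nullity then leaves no kernel.
  have hle : LinearMap.range (Matrix.of fun l k => inner ℝ (φ l) (φ k)).mulVecLin
      ≤ LinearMap.range X := by
    rintro _ ⟨u, rfl⟩
    refine ⟨∑ k, u k • φ k, ?_⟩
    ext l
    rw [hX, Matrix.mulVecLin_apply, gram_mulVec]
  have h1 : Module.finrank ℝ E ≤ Module.finrank ℝ (LinearMap.range X) := by
    rw [← h]
    exact Submodule.finrank_mono hle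
  have h2 := X.finrank_range_add_finrank_ker
  have h3 : LinearMap.ker X = ⊥ := Submodule.finrank_eq_zero.1 (by omega)
  intro v hv
  have : v ∈ LinearMap.ker X := by
    rw [LinearMap.mem_ker]
    ext l
    rw [hX]
    exact hv l
  rw [h3] at this
  exact this

/-- The smallest positive eigenvalue of the Gram matrix of a separating family is the minimum of
the energy on the unit sphere. -/
theorem exists_minPosEigenvalue_eq [Nontrivial E] {φ : Fin m → E} (h : Separates φ) :
    ∃ v₀ ∈ Metric.sphere (0 : E) 1,
      minPosEigenvalue (Matrix.of fun l k => inner ℝ (φ l) (φ k)) = frameEnergy φ v₀ ∧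
      ∀ v ∈ Metric.sphere (0 : E) 1, frameEnergy φ v₀ ≤ frameEnergy φ v := by
  obtain ⟨v₀, hv₀, hmin⟩ := (isCompact_sphere (0 : E) 1).exists_isMinOn
    (NormedSpace.sphere_nonempty.2 zero_le_one) (continuous_frameEnergy φ).continuousOn
  have hle : ∀ v ∈ Metric.sphere (0 : E) 1, frameEnergy φ v₀ ≤ frameEnergy φ v :=
    fun v hv => hmin hv
  refine ⟨v₀, hv₀, ?_, hle⟩
  have hv₀' : ‖v₀‖ = 1 := by simpa using hv₀
  have hv₀0 : v₀ ≠ 0 := by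
    rw [← norm_ne_zero_iff, hv₀']
    exact one_ne_zero
  have hlow := mul_norm_sq_le_of_sphere (frameEnergy_smul φ) hle
  set t := frameEnergy φ v₀ with ht
  have htpos : 0 < t := frameEnergy_pos h hv₀0
  -- The form `frameEnergy φ v - t * ‖v‖ ^ 2` is nonnegative and vanishes at `v₀`, so its first
  -- variation there vanishes: `v₀` is an eigenvector of `Xᵀ X`.
  have hstat : ∀ v, ∑ l, inner ℝ (φ l) v₀ * inner ℝ (φ l) v = t * inner ℝ v₀ v := by
    intro v
    refine sub_eq_zero.1 (linear_coeff_eq_zero (c := frameEnergy φ v - t * ‖v‖ ^ 2) fun s => ?_)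
    have := hlow (v₀ + s • v)
    rw [frameEnergy_add_smul, norm_add_smul_sq, hv₀', ← ht] at this
    linarith
  have heig : ∑ l, inner ℝ (φ l) v₀ • φ l = t • v₀ := by
    refine ext_inner_right ℝ fun v => ?_
    simpa only [sum_inner, real_inner_smul_left] using hstat v
  refine IsLeast.csInf_eq ⟨⟨htpos, ?_⟩, ?_⟩
  -- `X v₀` is an eigenvector of `X Xᵀ`; it is nonzero because the family separates.
  · refine Module.End.hasEigenvalue_of_hasEigenvector (x := fun l => inner ℝ (φ l) v₀)
      ⟨Module.End.mem_eigenspace_iff.2 ?_, fun h0 => hv₀0 (h v₀ fun l => congrFun h0 l)⟩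
    ext l
    rw [Matrix.toLin'_apply, gram_mulVec, heig, inner_smul_right]
    rfl
  · rintro s ⟨hs, hes⟩
    obtain ⟨u, hu⟩ := hes.exists_hasEigenvector
    have hGu : ∀ l, inner ℝ (φ l) (∑ k, u k • φ k) = s * u l := fun l => by
      rw [← gram_mulVec, ← Matrix.toLin'_apply, hu.apply_eq_smul]
      rfl
    -- Conversely, if `G u = s u`, then `Xᵀ u` has energy `s² |u|²` and squared norm `s |u|²`, so
    -- its Rayleigh quotient is `s` and minimality gives `t ≤ s`.
    have h1 : frameEnergy φ (∑ k, u k • φ k) = s ^ 2 * ∑ l, u l ^ 2 := by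
      simp only [frameEnergy, hGu, mul_pow, Finset.mul_sum]
    have h2 : ‖∑ k, u k • φ k‖ ^ 2 = s * ∑ l, u l ^ 2 := by
      rw [← real_inner_self_eq_norm_sq]
      conv_lhs => rw [sum_inner]
      simp only [real_inner_smul_left, hGu, Finset.mul_sum]
      exact Finset.sum_congr rfl fun l _ => by ring
    have h3 := hlow (∑ k, u k • φ k)
    rw [h1, h2] at h3
    have hU : 0 < ∑ l, u l ^ 2 := by
      obtain ⟨l, hl⟩ := Function.ne_iff.1 hu.2
      exact Finset.sum_pos' (fun _ _ => sq_nonneg _)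
        ⟨l, Finset.mem_univ l, by have : u l ≠ 0 := hl; positivity⟩
    have h4 : 0 < s * ∑ l, u l ^ 2 := mul_pos hs hU
    nlinarith

/-- The Gram matrix of a separating family has a smallest positive eigenvalue, and it is a lower
frame bound. -/
theorem minPosEigenvalue_gram_pos [Nontrivial E] {φ : Fin m → E} (h : Separates φ) :
    0 < minPosEigenvalue (Matrix.of fun l k => inner ℝ (φ l) (φ k)) ∧
      ∀ v, minPosEigenvalue (Matrix.of fun l k => inner ℝ (φ l) (φ k)) * ‖v‖ ^ 2
        ≤ frameEnergy φ v := by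
  obtain ⟨v₀, hv₀, heq, hle⟩ := exists_minPosEigenvalue_eq h
  rw [heq]
  refine ⟨frameEnergy_pos h ?_, mul_norm_sq_le_of_sphere (frameEnergy_smul φ) hle⟩
  rintro rfl
  simp at hv₀

end Frame

/-! ### Ridge regression -/

section Ridge

variable {E : Type*} [NormedAddCommGroup E] [InnerProductSpace ℝ E] {m : ℕ}

/-- The normal equations of ridge regression with regressors `φ`, targets `t` and penalty `lam`. -/
def IsRidgeSolution (φ : Fin m → E) (t : Fin m → ℝ) (lam : ℝ) (w : E) : Prop :=
  ∀ v, ∑ l, (inner ℝ (φ l) w - t l) * inner ℝ (φ l) v + lam * inner ℝ w v = 0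

/-- Along a line through `w` the increase of the objective is a nonnegative quadratic without
constant term, so its linear coefficient vanishes. -/
theorem isRidgeSolution_of_minimizer {φ : Fin m → E} {t : Fin m → ℝ} {lam : ℝ} {w : E}
    (h : ∀ w', ∑ l, (inner ℝ (φ l) w - t l) ^ 2 + lam * ‖w‖ ^ 2
      ≤ ∑ l, (inner ℝ (φ l) w' - t l) ^ 2 + lam * ‖w'‖ ^ 2) :
    IsRidgeSolution φ t lam w := by
  intro v
  refine linear_coeff_eq_zero (c := frameEnergy φ v + lam * ‖v‖ ^ 2) fun s => ?_
  have h1 := h (w + s • v)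
  have h2 : ∑ l, (inner ℝ (φ l) (w + s • v) - t l) ^ 2
      = ∑ l, (inner ℝ (φ l) w - t l) ^ 2
        + 2 * s * ∑ l, (inner ℝ (φ l) w - t l) * inner ℝ (φ l) v + s ^ 2 * frameEnergy φ v := by
    simp only [frameEnergy, inner_add_right, inner_smul_right, Finset.mul_sum,
      ← Finset.sum_add_distrib]
    exact Finset.sum_congr rfl fun l _ => by ring
  rw [h2, norm_add_smul_sq] at h1
  linarith

/-- Stability of ridge regression: distance of the ridge solution to an arbitrary parameter. -/
theorem IsRidgeSolution.norm_sub_le {φ : Fin m → E} {t : Fin m → ℝ} {lam γ : ℝ} {w : E}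
    (hw : IsRidgeSolution φ t lam w) (hlam : 0 ≤ lam) (hγ : 0 < γ)
    (hframe : ∀ v, γ * ‖v‖ ^ 2 ≤ frameEnergy φ v) (w' : E) :
    ‖w' - w‖ ≤ √(∑ l, (inner ℝ (φ l) w' - t l) ^ 2) / √(γ + lam) + lam / (γ + lam) * ‖w'‖ := by
  set d := w' - w with hd
  set e := √(∑ l, (inner ℝ (φ l) w' - t l) ^ 2) with he
  have hgl : 0 < γ + lam := by linarith
  set g := √(γ + lam) with hg
  have hgpos : 0 < g := Real.sqrt_pos.2 hgl
  have hgsq : g ^ 2 = γ + lam := Real.sq_sqrt hgl.le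
  have hnn : 0 ≤ frameEnergy φ d + lam * ‖d‖ ^ 2 :=
    add_nonneg (frameEnergy_nonneg φ d) (by positivity)
  -- `n` is the norm of `d` for the ridge Hessian. It dominates both `‖X d‖` and `√(γ + lam) ‖d‖`,
  -- which lets both terms of the balance below be bounded linearly in `n`.
  set n := √(frameEnergy φ d + lam * ‖d‖ ^ 2) with hn
  have hnsq : n ^ 2 = frameEnergy φ d + lam * ‖d‖ ^ 2 := Real.sq_sqrt hnn
  have hn0 : 0 ≤ n := Real.sqrt_nonneg _
  have hgd : g * ‖d‖ ≤ n := by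
    refine Real.le_sqrt_of_sq_le ?_
    have := hframe d
    rw [mul_pow, hgsq]
    linarith
  -- The normal equations at `w = w' - d`, tested against `d` itself.
  have hbal : n ^ 2
      = ∑ l, (inner ℝ (φ l) w' - t l) * inner ℝ (φ l) d + lam * inner ℝ w' d := by
    have h1 := hw d
    have h2 : w = w' - d := by rw [hd]; abel
    have h3 : ∑ l, (inner ℝ (φ l) w - t l) * inner ℝ (φ l) d
        = ∑ l, (inner ℝ (φ l) w' - t l) * inner ℝ (φ l) d - frameEnergy φ d := by
      rw [frameEnergy, ← Finset.sum_sub_distrib]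
      refine Finset.sum_congr rfl fun l _ => ?_
      rw [h2, inner_sub_right]
      ring
    rw [h3] at h1
    nth_rewrite 1 [h2] at h1
    rw [inner_sub_left, real_inner_self_eq_norm_sq] at h1
    rw [hnsq]
    linarith
  have hcs : ∑ l, (inner ℝ (φ l) w' - t l) * inner ℝ (φ l) d ≤ e * n := by
    refine (Real.sum_mul_le_sqrt_mul_sqrt _ _ _).trans ?_
    refine mul_le_mul_of_nonneg_left (Real.sqrt_le_sqrt ?_) (Real.sqrt_nonneg _)
    have : 0 ≤ lam * ‖d‖ ^ 2 := by positivity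
    unfold frameEnergy
    linarith
  have hin : inner ℝ w' d ≤ ‖w'‖ * (n / g) :=
    (real_inner_le_norm w' d).trans
      (mul_le_mul_of_nonneg_left ((le_div_iff₀' hgpos).2 hgd) (norm_nonneg _))
  have hn_le : n ≤ e + lam * ‖w'‖ / g := by
    rcases hn0.eq_or_lt with h0 | h0
    · rw [← h0]
      exact add_nonneg (Real.sqrt_nonneg _) (by positivity)
    · have h1 : n * n ≤ (e + lam * ‖w'‖ / g) * n := by
        have := mul_le_mul_of_nonneg_left hin hlam
        calc n * n = n ^ 2 := by ring
          _ ≤ e * n + lam * (‖w'‖ * (n / g)) := by rw [hbal]; linarith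
          _ = _ := by ring
      exact le_of_mul_le_mul_right h1 h0
  calc ‖d‖ ≤ n / g := (le_div_iff₀' hgpos).2 hgd
    _ ≤ (e + lam * ‖w'‖ / g) / g := by gcongr
    _ = e / g + lam / (g ^ 2) * ‖w'‖ := by field_simp
    _ = _ := by rw [hgsq]

/-- Ridge solutions with penalty tending to `0` converge to the least squares solution. -/
theorem exists_tendsto_ridgeSolution [FiniteDimensional ℝ E] {φ : Fin m → E} {t : Fin m → ℝ}
    {γ : ℝ} (hγ : 0 < γ) (hframe : ∀ v, γ * ‖v‖ ^ 2 ≤ frameEnergy φ v) {w : ℝ → E}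
    (hw : ∀ lam, 0 < lam → IsRidgeSolution φ t lam (w lam)) :
    ∃ w₀, Tendsto w (𝓝[>] 0) (𝓝 w₀) := by
  -- `T = Xᵀ X`. The frame bound makes it injective, hence surjective in finite dimension, so the
  -- equations with zero penalty have a solution `w₀`.
  let T : E →ₗ[ℝ] E := ∑ l, (innerSL ℝ (φ l)).toLinearMap.smulRight (φ l)
  have hT : ∀ v, T v = ∑ l, inner ℝ (φ l) v • φ l := fun v => by simp [T]
  have hinj : Function.Injective T := by
    rw [injective_iff_map_eq_zero]
    intro v hv
    have h1 : frameEnergy φ v = 0 := by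
      have h2 : inner ℝ (T v) v = frameEnergy φ v := by
        rw [hT, sum_inner]
        simp only [real_inner_smul_left, frameEnergy, sq]
      rw [← h2, hv, inner_zero_left]
    have h2 := hframe v
    rw [h1] at h2
    have h3 : ‖v‖ ^ 2 ≤ 0 := by
      by_contra! h4
      exact absurd h2 (not_le.2 (mul_pos hγ h4))
    exact norm_eq_zero.1 (pow_eq_zero_iff two_ne_zero |>.1 (le_antisymm h3 (sq_nonneg _)))
  obtain ⟨w₀, hw₀⟩ := LinearMap.surjective_of_injective hinj (∑ l, t l • φ l)
  have hw₀' : ∀ v, ∑ l, (inner ℝ (φ l) w₀ - t l) * inner ℝ (φ l) v = 0 := by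
    intro v
    have h1 := congrArg (fun u => inner ℝ u v) hw₀
    simp only [hT, sum_inner, real_inner_smul_left] at h1
    simp only [sub_mul, Finset.sum_sub_distrib]
    linarith
  refine ⟨w₀, tendsto_iff_norm_sub_tendsto_zero.2 ?_⟩
  have hlim : Tendsto (fun lam : ℝ => lam / γ * ‖w₀‖) (𝓝[>] 0) (𝓝 0) := by
    have : Tendsto (fun lam : ℝ => lam / γ * ‖w₀‖) (𝓝 0) (𝓝 (0 / γ * ‖w₀‖)) := by
      refine Continuous.tendsto ?_ 0
      fun_prop
    rw [zero_div, zero_mul] at this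
    exact this.mono_left nhdsWithin_le_nhds
  refine squeeze_zero' (Eventually.of_forall fun _ => norm_nonneg _) ?_ hlim
  filter_upwards [self_mem_nhdsWithin] with lam hlam
  have hlam : 0 < lam := hlam
  set d := w lam - w₀ with hd
  -- Difference of the normal equations for `lam` and for zero penalty, tested against `d`; with the
  -- frame bound it gives `‖d‖ ≤ lam / γ * ‖w₀‖`.
  have h1 : frameEnergy φ d + lam * ‖d‖ ^ 2 + lam * inner ℝ w₀ d = 0 := by
    have h2 := hw lam hlam d
    have h3 : w lam = w₀ + d := by rw [hd]; abel
    have h4 : ∑ l, (inner ℝ (φ l) (w lam) - t l) * inner ℝ (φ l) d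
        = ∑ l, (inner ℝ (φ l) w₀ - t l) * inner ℝ (φ l) d + frameEnergy φ d := by
      rw [frameEnergy, ← Finset.sum_add_distrib]
      refine Finset.sum_congr rfl fun l _ => ?_
      rw [h3, inner_add_right]
      ring
    rw [h4, hw₀', h3, inner_add_left, real_inner_self_eq_norm_sq] at h2
    linarith
  have h2 := hframe d
  have h3 : -(‖w₀‖ * ‖d‖) ≤ inner ℝ w₀ d := neg_le_of_abs_le (abs_real_inner_le_norm w₀ d)
  have h4 : γ * ‖d‖ ^ 2 ≤ lam * ‖w₀‖ * ‖d‖ := by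
    have h5 := mul_le_mul_of_nonneg_left h3 hlam.le
    have h6 : 0 ≤ lam * ‖d‖ ^ 2 := by positivity
    linarith
  rcases (norm_nonneg d).eq_or_lt with h0 | h0
  · rw [← h0]
    positivity
  · have h5 : γ * ‖d‖ ≤ lam * ‖w₀‖ :=
      le_of_mul_le_mul_right (by linarith [sq (‖d‖)]) h0
    calc ‖d‖ ≤ lam * ‖w₀‖ / γ := (le_div_iff₀' hγ).2 h5
      _ = lam / γ * ‖w₀‖ := by ring

end Ridge

/-! ### Uniform law of large numbers for quadratic forms -/

section SecondMoment

variable {S E : Type*} [MeasurableSpace S] [NormedAddCommGroup E] [InnerProductSpace ℝ E]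

/-- Separates `v` from `x`: convergence of the finitely many moments of basis coordinates controls
all `v` at once. -/
theorem inner_sq_eq_sum_basis {ι : Type*} [Fintype ι] (b : OrthonormalBasis ι ℝ E) (x v : E) :
    (inner ℝ x v) ^ 2
      = ∑ j, ∑ k, inner ℝ (b j) v * inner ℝ (b k) v * (inner ℝ x (b j) * inner ℝ x (b k)) := by
  rw [← b.sum_inner_mul_inner x v, sq, Finset.sum_mul_sum]
  exact Finset.sum_congr rfl fun j _ => Finset.sum_congr rfl fun k _ => by ring

theorem integrable_inner_mul_inner {ν : Measure S} [IsFiniteMeasure ν] {φ : S → E}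
    (hmeas : ∀ v, Measurable fun s => inner ℝ (φ s) v) (hbdd : ∀ s, ‖φ s‖ ≤ 1) (v w : E) :
    Integrable (fun s => inner ℝ (φ s) v * inner ℝ (φ s) w) ν := by
  refine Integrable.of_bound ((hmeas v).mul (hmeas w)).aestronglyMeasurable (‖v‖ * ‖w‖)
    (Eventually.of_forall fun s => ?_)
  have h : ∀ u : E, ‖inner ℝ (φ s) u‖ ≤ ‖u‖ := fun u =>
    (norm_inner_le_norm (φ s) u).trans (mul_le_of_le_one_left (norm_nonneg u) (hbdd s))
  rw [norm_mul]
  exact mul_le_mul (h v) (h w) (norm_nonneg _) (norm_nonneg _)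

theorem integral_inner_sq_eq_sum_basis {ν : Measure S} [IsFiniteMeasure ν] {φ : S → E}
    (hmeas : ∀ v, Measurable fun s => inner ℝ (φ s) v) (hbdd : ∀ s, ‖φ s‖ ≤ 1)
    {ι : Type*} [Fintype ι] (b : OrthonormalBasis ι ℝ E) (v : E) :
    ∫ s, (inner ℝ (φ s) v) ^ 2 ∂ν
      = ∑ j, ∑ k, inner ℝ (b j) v * inner ℝ (b k) v
          * ∫ s, inner ℝ (φ s) (b j) * inner ℝ (φ s) (b k) ∂ν := by
  have hint : ∀ j k, Integrable (fun s => inner ℝ (b j) v * inner ℝ (b k) v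
      * (inner ℝ (φ s) (b j) * inner ℝ (φ s) (b k))) ν :=
    fun j k => (integrable_inner_mul_inner hmeas hbdd (b j) (b k)).const_mul _
  simp only [fun s => inner_sq_eq_sum_basis b (φ s) v]
  rw [integral_finsetSum _ fun j _ => integrable_finsetSum _ fun k _ => hint j k]
  refine Finset.sum_congr rfl fun j _ => ?_
  rw [integral_finsetSum _ fun k _ => hint j k]
  exact Finset.sum_congr rfl fun k _ => integral_const_mul _ _

variable [FiniteDimensional ℝ E]

theorem continuous_integral_inner_sq {ν : Measure S} [IsFiniteMeasure ν] {φ : S → E}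
    (hmeas : ∀ v, Measurable fun s => inner ℝ (φ s) v) (hbdd : ∀ s, ‖φ s‖ ≤ 1) :
    Continuous fun v => ∫ s, (inner ℝ (φ s) v) ^ 2 ∂ν := by
  simp only [integral_inner_sq_eq_sum_basis hmeas hbdd (stdOrthonormalBasis ℝ E)]
  fun_prop

/-- The empirical second moments of i.i.d. samples converge almost surely, uniformly on the unit
sphere. -/
theorem ae_uniform_secondMoment {ν : Measure S} [IsProbabilityMeasure ν] {φ : S → E}
    (hmeas : ∀ v, Measurable fun s => inner ℝ (φ s) v) (hbdd : ∀ s, ‖φ s‖ ≤ 1)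
    {Ω : Type*} [MeasurableSpace Ω] {Pr : Measure Ω} [IsProbabilityMeasure Pr]
    {anchor : ℕ → Ω → S} (ha : ∀ l, Measurable (anchor l)) (hlaw : ∀ l, Pr.map (anchor l) = ν)
    (hind : iIndepFun anchor Pr) :
    ∀ᵐ ω ∂Pr, ∃ η : ℕ → ℝ, Tendsto η atTop (𝓝 0) ∧ ∀ m, ∀ v ∈ Metric.sphere (0 : E) 1,
      |(∑ l : Fin m, (inner ℝ (φ (anchor l ω)) v) ^ 2) / m - ∫ s, (inner ℝ (φ s) v) ^ 2 ∂ν|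
        ≤ η m := by
  let b := stdOrthonormalBasis ℝ E
  let p : Fin (Module.finrank ℝ E) → Fin (Module.finrank ℝ E) → S → ℝ :=
    fun j k s => inner ℝ (φ s) (b j) * inner ℝ (φ s) (b k)
  have hp : ∀ j k, Measurable (p j k) := fun j k => (hmeas _).mul (hmeas _)
  have hslln : ∀ j k, ∀ᵐ ω ∂Pr, Tendsto
      (fun m : ℕ => (∑ l ∈ Finset.range m, p j k (anchor l ω)) / m) atTop
      (𝓝 (∫ s, p j k s ∂ν)) := by
    intro j k
    have h1 := strong_law_ae_real (μ := Pr) (fun l ω => p j k (anchor l ω)) ?_ ?_ ?_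
    · have h2 : ∫ ω, p j k (anchor 0 ω) ∂Pr = ∫ s, p j k s ∂ν := by
        rw [← hlaw 0, integral_map (ha 0).aemeasurable (hp j k).aestronglyMeasurable]
      simpa only [h2] using h1
    · have h3 : Integrable (p j k) ν := integrable_inner_mul_inner hmeas hbdd (b j) (b k)
      rw [← hlaw 0] at h3
      exact h3.comp_measurable (ha 0)
    · intro l l' hl
      exact (hind.indepFun hl).comp (hp j k) (hp j k)
    · intro l
      exact IdentDistrib.comp (u := p j k)
        ⟨(ha l).aemeasurable, (ha 0).aemeasurable, by rw [hlaw, hlaw]⟩ (hp j k)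
  have hslln' := ae_all_iff.2 fun j => ae_all_iff.2 fun k => hslln j k
  filter_upwards [hslln'] with ω hω
  -- The total error of all moments serves for every unit `v`, since the coefficients `⟪b j, v⟫ ⟪b
  -- k, v⟫` are at most `1` in absolute value.
  refine ⟨fun m => ∑ j, ∑ k,
    |(∑ l ∈ Finset.range m, p j k (anchor l ω)) / m - ∫ s, p j k s ∂ν|, ?_, fun m v hv => ?_⟩
  · have h0 : (0 : ℝ) = ∑ j : Fin (Module.finrank ℝ E), ∑ k : Fin (Module.finrank ℝ E), (0 : ℝ) := by
      simp
    rw [h0]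
    refine tendsto_finsetSum _ fun j _ => tendsto_finsetSum _ fun k _ => ?_
    have h1 := ((hω j k).sub_const (∫ s, p j k s ∂ν)).abs
    rwa [sub_self, abs_zero] at h1
  · have hv1 : ‖v‖ = 1 := by simpa using hv
    have hb : ∀ j, |inner ℝ (b j) v| ≤ 1 := fun j => by
      have := abs_real_inner_le_norm (b j) v
      rwa [b.orthonormal.1 j, hv1, one_mul] at this
    have hemp : (∑ l : Fin m, (inner ℝ (φ (anchor l ω)) v) ^ 2) / m
        = ∑ j, ∑ k, inner ℝ (b j) v * inner ℝ (b k) v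
          * ((∑ l ∈ Finset.range m, p j k (anchor l ω)) / m) := by
      rw [Fin.sum_univ_eq_sum_range (fun l => (inner ℝ (φ (anchor l ω)) v) ^ 2) m]
      simp only [inner_sq_eq_sum_basis b _ v]
      rw [Finset.sum_comm, Finset.sum_div]
      refine Finset.sum_congr rfl fun j _ => ?_
      rw [Finset.sum_comm, Finset.sum_div]
      refine Finset.sum_congr rfl fun k _ => ?_
      rw [← Finset.mul_sum, mul_div_assoc]
    rw [hemp, integral_inner_sq_eq_sum_basis hmeas hbdd b, ← Finset.sum_sub_distrib]
    refine (Finset.abs_sum_le_sum_abs _ _).trans (Finset.sum_le_sum fun j _ => ?_)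
    rw [← Finset.sum_sub_distrib]
    refine (Finset.abs_sum_le_sum_abs _ _).trans (Finset.sum_le_sum fun k _ => ?_)
    rw [← mul_sub, abs_mul, abs_mul]
    exact mul_le_of_le_one_left (abs_nonneg _) (mul_le_one₀ (hb j) (abs_nonneg _) (hb k))

theorem exists_iInf_secondMoment_eq [Nontrivial E] {ν : Measure S} [IsFiniteMeasure ν] {φ : S → E}
    (hmeas : ∀ v, Measurable fun s => inner ℝ (φ s) v) (hbdd : ∀ s, ‖φ s‖ ≤ 1) :
    ∃ v₀ ∈ Metric.sphere (0 : E) 1,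
      (⨅ v : Metric.sphere (0 : E) 1, ∫ s, (inner ℝ (φ s) (v : E)) ^ 2 ∂ν)
        = ∫ s, (inner ℝ (φ s) v₀) ^ 2 ∂ν ∧
      ∀ v ∈ Metric.sphere (0 : E) 1,
        ∫ s, (inner ℝ (φ s) v₀) ^ 2 ∂ν ≤ ∫ s, (inner ℝ (φ s) v) ^ 2 ∂ν := by
  obtain ⟨v₀, hv₀, hmin⟩ := (isCompact_sphere (0 : E) 1).exists_isMinOn
    (NormedSpace.sphere_nonempty.2 zero_le_one)
    (continuous_integral_inner_sq (ν := ν) hmeas hbdd).continuousOn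
  have hle : ∀ v ∈ Metric.sphere (0 : E) 1,
      ∫ s, (inner ℝ (φ s) v₀) ^ 2 ∂ν ≤ ∫ s, (inner ℝ (φ s) v) ^ 2 ∂ν := fun v hv => hmin hv
  refine ⟨v₀, hv₀, le_antisymm ?_ ?_, hle⟩
  · refine ciInf_le (f := fun v : Metric.sphere (0 : E) 1 => ∫ s, (inner ℝ (φ s) (v : E)) ^ 2 ∂ν)
      ⟨0, ?_⟩ ⟨v₀, hv₀⟩
    rintro _ ⟨v, rfl⟩
    exact integral_nonneg fun s => sq_nonneg _
  · have : Nonempty (Metric.sphere (0 : E) 1) := ⟨⟨v₀, hv₀⟩⟩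
    exact le_ciInf fun v => hle v v.2

end SecondMoment

/-! ### Read-outs as real inner products -/

section Readout

variable {S A 𝕜 : Type*} [RCLike 𝕜] {D m : ℕ}

/-- The reduction that treats `𝕜 = ℝ` and `𝕜 = ℂ` together, over a real space of dimension `D *
finrank ℝ 𝕜`. -/
theorem readout_eq_inner (Φ : S → EuclideanSpace 𝕜 (Fin D)) (w : EuclideanSpace 𝕜 (Fin D))
    (s : S) : readout Φ w s = inner ℝ (Φ s) w := by
  simp only [readout, PiLp.inner_apply, map_sum]
  rfl

theorem abs_readout_le {Φ : S → EuclideanSpace 𝕜 (Fin D)} (hΦ : ∀ s, ‖Φ s‖ ≤ 1)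
    (w : EuclideanSpace 𝕜 (Fin D)) (s : S) : |readout Φ w s| ≤ ‖w‖ :=
  ((RCLike.abs_re_le_norm _).trans (norm_inner_le_norm (Φ s) w)).trans
    (mul_le_of_le_one_left (norm_nonneg w) (hΦ s))

theorem measurable_inner_encoder [MeasurableSpace S] {Φ : S → EuclideanSpace 𝕜 (Fin D)}
    (hΦ : Measurable Φ) (v : EuclideanSpace 𝕜 (Fin D)) :
    Measurable fun s => (inner ℝ (Φ s) v : ℝ) := by
  have h : Continuous fun x : EuclideanSpace 𝕜 (Fin D) => (inner ℝ x v : ℝ) := by fun_prop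
  exact h.measurable.comp hΦ

theorem readout_sub (Φ : S → EuclideanSpace 𝕜 (Fin D)) (v w : EuclideanSpace 𝕜 (Fin D)) (s : S) :
    readout Φ (v - w) s = readout Φ v s - readout Φ w s := by
  simp only [readout, inner_sub_right, map_sub]

theorem continuous_readout (Φ : S → EuclideanSpace 𝕜 (Fin D)) (s : S) :
    Continuous fun w => readout Φ w s := by
  unfold readout
  fun_prop

theorem finrank_real_euclideanSpace :
    Module.finrank ℝ (EuclideanSpace 𝕜 (Fin D)) = D * Module.finrank ℝ 𝕜 := by
  rw [← Module.finrank_mul_finrank ℝ 𝕜 (EuclideanSpace 𝕜 (Fin D)), finrank_euclideanSpace_fin,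
    mul_comm]

theorem anchorGram_eq_gram (Φ : S → EuclideanSpace 𝕜 (Fin D)) (x : Fin m → S) :
    anchorGram Φ x = Matrix.of fun l k => (inner ℝ (Φ (x l)) (Φ (x k)) : ℝ) := by
  ext l k
  exact readout_eq_inner Φ (Φ (x k)) (x l)

theorem anchorGamma_eq (Φ : S → EuclideanSpace 𝕜 (Fin D)) (x : Fin m → S) :
    anchorGamma Φ x
      = minPosEigenvalue (Matrix.of fun l k => (inner ℝ (Φ (x l)) (Φ (x k)) : ℝ)) := by
  rw [anchorGamma, anchorGram_eq_gram]

theorem separates_of_rank_anchorGram {Φ : S → EuclideanSpace 𝕜 (Fin D)} {x : Fin m → S}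
    (h : (anchorGram Φ x).rank = D * Module.finrank ℝ 𝕜) : Separates fun l => Φ (x l) := by
  refine separates_of_rank_gram ?_
  rw [← anchorGram_eq_gram, h, finrank_real_euclideanSpace]

theorem norm_le_frobNorm [Fintype A] (W : A → EuclideanSpace 𝕜 (Fin D)) (a : A) :
    ‖W a‖ ≤ frobNorm W :=
  Real.le_sqrt_of_sq_le
    (Finset.single_le_sum (f := fun a => ‖W a‖ ^ 2) (fun _ _ => sq_nonneg _) (Finset.mem_univ a))

/-- The ridge problem decouples over the actions. -/
theorem ridgeObjective_eq_sum [Fintype A] (Φ : S → EuclideanSpace 𝕜 (Fin D)) (x : Fin m → S)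
    (T : Fin m → A → ℝ) (lam : ℝ) (W : A → EuclideanSpace 𝕜 (Fin D)) :
    ridgeObjective Φ x T lam W
      = ∑ a, (∑ l, (inner ℝ (Φ (x l)) (W a) - T l a) ^ 2 + lam * ‖W a‖ ^ 2) := by
  rw [ridgeObjective, frobNorm, Real.sq_sqrt (Finset.sum_nonneg fun _ _ => sq_nonneg _),
    Finset.sum_comm, Finset.mul_sum, ← Finset.sum_add_distrib]
  simp only [readout_eq_inner]

theorem IsCompiled.isRidgeSolution [Fintype A] {Φ : S → EuclideanSpace 𝕜 (Fin D)} {x : Fin m → S}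
    {T : Fin m → A → ℝ} {lam : ℝ} {W : A → EuclideanSpace 𝕜 (Fin D)}
    (h : IsCompiled Φ x T lam W) (a : A) :
    IsRidgeSolution (fun l => Φ (x l)) (fun l => T l a) lam (W a) := by
  classical
  refine isRidgeSolution_of_minimizer fun w' => ?_
  -- Only column `a` is varied, so the summands of the other actions cancel.
  have h1 := h (Function.update W a w')
  rw [ridgeObjective_eq_sum, ridgeObjective_eq_sum,
    ← Finset.add_sum_erase _ _ (Finset.mem_univ a),
    ← Finset.add_sum_erase (a := a) _ _ (Finset.mem_univ a),
    Finset.sum_congr rfl (g := fun b =>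
      ∑ l, (inner ℝ (Φ (x l)) (W b) - T l b) ^ 2 + lam * ‖W b‖ ^ 2)
      (s₁ := Finset.univ.erase a) (f := fun b =>
      ∑ l, (inner ℝ (Φ (x l)) (Function.update W a w' b) - T l b) ^ 2
        + lam * ‖Function.update W a w' b‖ ^ 2)
      fun b hb => by rw [Function.update_of_ne (Finset.ne_of_mem_erase hb)],
    Function.update_self] at h1
  exact le_of_add_le_add_right h1

end Readout

/-! ### Disagreement of the oracles -/

section Heterogeneity

variable {S A 𝕜 H : Type*} [RCLike 𝕜] [NormedAddCommGroup H] [InnerProductSpace ℝ H]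

theorem norm_sub_le_repError [Finite A] {D : ℕ} (J : EuclideanSpace 𝕜 (Fin D) →ₗ[ℝ] H) (Q : A → H)
    (W : A → EuclideanSpace 𝕜 (Fin D)) (a : A) : ‖Q a - J (W a)‖ ≤ repError J Q W :=
  le_ciSup (f := fun a => ‖Q a - J (W a)‖) (Set.finite_range _).bddAbove a

theorem sin_principalAngle_nonneg (U V : Submodule ℝ H) [U.HasOrthogonalProjection]
    [V.HasOrthogonalProjection] : 0 ≤ Real.sin (principalAngle U V) := by
  have h : 0 ≤ principalAngle U V :=
    Real.arcsin_nonneg.2 (le_min (norm_nonneg _) (norm_nonneg _))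
  exact Real.sin_nonneg_of_nonneg_of_le_pi h
    ((Real.arcsin_le_pi_div_two _).trans (by linarith [Real.pi_pos]))

variable {N : ℕ} {D : Fin N → ℕ} {weight : Fin N → ℝ} {B : ℝ}
  {J : ∀ i, EuclideanSpace 𝕜 (Fin (D i)) →ₗ[ℝ] H} {Q : A → H}
  {W : ∀ i, A → EuclideanSpace 𝕜 (Fin (D i))}

/-- The term `j = i` vanishes; for the others the triangle inequality through `Q a` yields the two
representation errors, and the angle term only enlarges the bound. -/
theorem sum_weight_norm_sub_le_heterogeneity [Finite A] (hweight : ∀ i, 0 ≤ weight i) (hB : 0 ≤ B)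
    (i : Fin N) (a : A) :
    ∑ j, weight j * ‖J i (W i a) - J j (W j a)‖ ≤ heterogeneity J Q W weight B i := by
  rw [← Finset.add_sum_erase _ _ (Finset.mem_univ i), sub_self, norm_zero, mul_zero, zero_add]
  refine Finset.sum_le_sum fun j _ => mul_le_mul_of_nonneg_left ?_ (hweight j)
  have h1 := norm_sub_le_norm_sub_add_norm_sub (J i (W i a)) (Q a) (J j (W j a))
  rw [norm_sub_rev (J i (W i a)) (Q a)] at h1
  have h2 := norm_sub_le_repError (J i) Q (W i) a
  have h3 := norm_sub_le_repError (J j) Q (W j) a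
  have h4 : 0 ≤ 2 * B * Real.sin (principalAngle (LinearMap.range (J i)) (LinearMap.range (J j))) :=
    mul_nonneg (by linarith) (sin_principalAngle_nonneg _ _)
  linarith

theorem heterogeneity_nonneg [Finite A] [Nonempty A] (hweight : ∀ i, 0 ≤ weight i) (hB : 0 ≤ B)
    (i : Fin N) : 0 ≤ heterogeneity J Q W weight B i :=
  (Finset.sum_nonneg fun j _ => mul_nonneg (hweight j) (norm_nonneg
    (J i (W i (Classical.arbitrary A)) - J j (W j (Classical.arbitrary A))))).trans
    (sum_weight_norm_sub_le_heterogeneity hweight hB i (Classical.arbitrary A))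

variable [CompleteSpace H] [RKHS ℝ H S ℝ]

/-- Reproducing property and Cauchy–Schwarz: evaluation at `s` is the inner product with a vector of
squared norm `κ(s,s)`. -/
theorem abs_apply_le_norm (hker : ∀ s : S, scalarKernel H s s ≤ 1) (f : H) (s : S) :
    |f s| ≤ ‖f‖ := by
  have h1 : scalarKernel H s s = ‖RKHS.kerFun H s (1 : ℝ)‖ ^ 2 := by
    have := RKHS.kernel_inner H s s (1 : ℝ) 1
    rw [real_inner_self_eq_norm_sq] at this
    rw [← this]
    simp [scalarKernel]
  have h2 : ‖RKHS.kerFun H s (1 : ℝ)‖ ≤ 1 := by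
    have := hker s
    rw [h1] at this
    exact (sq_le_one_iff₀ (norm_nonneg _)).1 this
  have h3 : f s = inner ℝ (RKHS.kerFun H s (1 : ℝ)) f := by simp
  rw [h3]
  exact (abs_real_inner_le_norm _ _).trans (mul_le_of_le_one_left (norm_nonneg f) h2)

/-- On the anchors the teacher deviates from the oracle by at most the heterogeneity. -/
theorem abs_readout_sub_teacher_le [Finite A] (hker : ∀ s : S, scalarKernel H s s ≤ 1)
    {Φ : ∀ i, S → EuclideanSpace 𝕜 (Fin (D i))} (hJ : ∀ i w s, J i w s = readout (Φ i) w s)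
    (hweight : ∀ i, 0 ≤ weight i) (hsum : ∑ i, weight i = 1) (hB : 0 ≤ B) (i : Fin N)
    {m : ℕ} (x : Fin m → S) (l : Fin m) (a : A) :
    |readout (Φ i) (W i a) (x l) - teacher Φ W weight x l a|
      ≤ heterogeneity J Q W weight B i := by
  -- The weights sum to `1`, so the oracle is a weighted average of copies of itself.
  have h1 : readout (Φ i) (W i a) (x l) - teacher Φ W weight x l a
      = ∑ j, weight j * (J i (W i a) - J j (W j a) : H) (x l) := by
    simp only [RKHS.coe_sub, Pi.sub_apply, hJ, mul_sub, Finset.sum_sub_distrib, ← Finset.sum_mul,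
      hsum, one_mul, teacher]
  rw [h1]
  refine (Finset.abs_sum_le_sum_abs _ _).trans
    ((Finset.sum_le_sum fun j _ => ?_).trans
      (sum_weight_norm_sub_le_heterogeneity hweight hB i a))
  rw [abs_mul, abs_of_nonneg (hweight j)]
  exact mul_le_mul_of_nonneg_left (abs_apply_le_norm hker _ _) (hweight j)

end Heterogeneity

/-! ### The federation gap for a fixed anchor set -/

section Gap

variable {S A 𝕜 : Type*} [Fintype A] [RCLike 𝕜] {D m : ℕ}
  {Φ : S → EuclideanSpace 𝕜 (Fin D)} {x : Fin m → S}

theorem nontrivial_euclideanSpace (hD : 0 < D) : Nontrivial (EuclideanSpace 𝕜 (Fin D)) := by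
  have : Nonempty (Fin D) := ⟨⟨0, hD⟩⟩
  infer_instance

theorem anchorGamma_pos (hD : 0 < D) (hsep : Separates fun l => Φ (x l)) :
    0 < anchorGamma Φ x := by
  have := nontrivial_euclideanSpace (𝕜 := 𝕜) hD
  rw [anchorGamma_eq]
  exact (minPosEigenvalue_gram_pos hsep).1

theorem anchorGamma_mul_le (hD : 0 < D) (hsep : Separates fun l => Φ (x l))
    (v : EuclideanSpace 𝕜 (Fin D)) :
    anchorGamma Φ x * ‖v‖ ^ 2 ≤ frameEnergy (fun l => Φ (x l)) v := by
  have := nontrivial_euclideanSpace (𝕜 := 𝕜) hD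
  rw [anchorGamma_eq]
  exact (minPosEigenvalue_gram_pos hsep).2 v

/-- Ridge stability with the oracle column as comparison parameter: its `m` residuals are each at
most `h`. The leading summand `h` is slack, added at the end. -/
theorem abs_fedGap_le (hΦ : ∀ s, ‖Φ s‖ ≤ 1) (hD : 0 < D) (hsep : Separates fun l => Φ (x l))
    {T : Fin m → A → ℝ} {What : A → EuclideanSpace 𝕜 (Fin D)} {h : ℝ} (hh : 0 ≤ h)
    (hT : ∀ l a, |readout Φ (What a) (x l) - T l a| ≤ h) {lam : ℝ} (hlam : 0 ≤ lam)
    {W : A → EuclideanSpace 𝕜 (Fin D)} (hW : IsCompiled Φ x T lam W) (s : S) (a : A) :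
    |fedGap Φ What W s a| ≤ h + √m / √(anchorGamma Φ x + lam) * h
      + lam / (anchorGamma Φ x + lam) * frobNorm What := by
  have hγ := anchorGamma_pos hD hsep
  have h1 := (hW.isRidgeSolution a).norm_sub_le hlam hγ (anchorGamma_mul_le hD hsep) (What a)
  have h2 : √(∑ l, ((inner ℝ (Φ (x l)) (What a) : ℝ) - T l a) ^ 2) ≤ √m * h := by
    refine (Real.sqrt_le_sqrt (y := m * h ^ 2) ?_).trans
      (by rw [Real.sqrt_mul (Nat.cast_nonneg m), Real.sqrt_sq hh])
    calc ∑ l, ((inner ℝ (Φ (x l)) (What a) : ℝ) - T l a) ^ 2 ≤ ∑ _l : Fin m, h ^ 2 := by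
          refine Finset.sum_le_sum fun l _ => ?_
          rw [← readout_eq_inner, ← sq_abs]
          exact pow_le_pow_left₀ (abs_nonneg _) (hT l a) 2
      _ = m * h ^ 2 := by simp
  rw [fedGap, ← readout_sub]
  calc |readout Φ (What a - W a) s| ≤ ‖What a - W a‖ := abs_readout_le hΦ _ s
    _ ≤ _ := h1
    _ ≤ √m * h / √(anchorGamma Φ x + lam)
        + lam / (anchorGamma Φ x + lam) * frobNorm What := by
      gcongr
      exact norm_le_frobNorm What a
    _ ≤ _ := by
      rw [mul_div_right_comm]
      linarith

theorem tendsto_ridgeShrinkage {γ : ℝ} (hγ : 0 < γ) (c : ℝ) :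
    Tendsto (fun lam : ℝ => lam / (γ + lam) * c) (𝓝[>] 0) (𝓝 0) := by
  have h : ContinuousAt (fun lam : ℝ => lam / (γ + lam) * c) 0 := by
    refine (continuousAt_id.div (by fun_prop) ?_).mul continuousAt_const
    simpa using hγ.ne'
  have h1 := h.tendsto
  simp only [zero_div, zero_mul] at h1
  exact h1.mono_left nhdsWithin_le_nhds

theorem exists_tendsto_fedGap (hΦ : ∀ s, ‖Φ s‖ ≤ 1) (hD : 0 < D)
    (hsep : Separates fun l => Φ (x l)) {T : Fin m → A → ℝ}
    {What : A → EuclideanSpace 𝕜 (Fin D)} {h : ℝ} (hh : 0 ≤ h)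
    (hT : ∀ l a, |readout Φ (What a) (x l) - T l a| ≤ h)
    {W : ℝ → A → EuclideanSpace 𝕜 (Fin D)} (hW : ∀ lam, 0 < lam → IsCompiled Φ x T lam (W lam))
    (s : S) (a : A) :
    ∃ δ : ℝ, Tendsto (fun lam => fedGap Φ What (W lam) s a) (𝓝[>] 0) (𝓝 δ) ∧
      |δ| ≤ (1 + √m / √(anchorGamma Φ x)) * h := by
  have hγ := anchorGamma_pos hD hsep
  obtain ⟨w₀, hw₀⟩ := exists_tendsto_ridgeSolution hγ (anchorGamma_mul_le hD hsep)
    (w := fun lam => W lam a) fun lam hlam => (hW lam hlam).isRidgeSolution a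
  have hlim : Tendsto (fun lam => fedGap Φ What (W lam) s a) (𝓝[>] 0)
      (𝓝 (readout Φ (What a) s - readout Φ w₀ s)) :=
    (((continuous_readout Φ s).tendsto w₀).comp hw₀).const_sub _
  refine ⟨_, hlim, ?_⟩
  have hsqrt : Tendsto (fun lam : ℝ => √m / √(anchorGamma Φ x + lam)) (𝓝[>] 0)
      (𝓝 (√m / √(anchorGamma Φ x))) := by
    have h1 : ContinuousAt (fun lam : ℝ => √m / √(anchorGamma Φ x + lam)) 0 := by
      refine continuousAt_const.div (by fun_prop) ?_
      simpa using (Real.sqrt_pos.2 hγ).ne'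
    have h2 := h1.tendsto
    rw [add_zero] at h2
    exact h2.mono_left nhdsWithin_le_nhds
  have hbound := ((hsqrt.mul_const h).const_add h).add
    (tendsto_ridgeShrinkage hγ (frobNorm What))
  have hle := le_of_tendsto_of_tendsto hlim.abs hbound <| by
    filter_upwards [self_mem_nhdsWithin] with lam hlam
    exact abs_fedGap_le hΦ hD hsep hh hT (le_of_lt hlam) (hW lam hlam) s a
  linarith

end Gap

/-! ### Asymptotics in the number of anchors -/

section Asymptotics

variable {S 𝕜 Ω : Type*} [RCLike 𝕜] [MeasurableSpace S] [MeasurableSpace Ω] {D : ℕ}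
  {Φ : S → EuclideanSpace 𝕜 (Fin D)} {ν : Measure S} {Pr : Measure Ω} {anchor : ℕ → Ω → S}

theorem populationGamma_nonneg : 0 ≤ populationGamma Φ ν :=
  Real.iInf_nonneg fun _ => integral_nonneg fun _ => sq_nonneg _

variable [IsProbabilityMeasure ν]

theorem exists_populationGamma_eq (hD : 0 < D) (hΦ_meas : Measurable Φ) (hΦ : ∀ s, ‖Φ s‖ ≤ 1) :
    ∃ v₀ ∈ Metric.sphere (0 : EuclideanSpace 𝕜 (Fin D)) 1,
      populationGamma Φ ν = ∫ s, (inner ℝ (Φ s) v₀ : ℝ) ^ 2 ∂ν ∧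
      ∀ v ∈ Metric.sphere (0 : EuclideanSpace 𝕜 (Fin D)) 1,
        ∫ s, (inner ℝ (Φ s) v₀ : ℝ) ^ 2 ∂ν ≤ ∫ s, (inner ℝ (Φ s) v : ℝ) ^ 2 ∂ν := by
  have := nontrivial_euclideanSpace (𝕜 := 𝕜) hD
  simp only [populationGamma, readout_eq_inner]
  exact exists_iInf_secondMoment_eq (measurable_inner_encoder hΦ_meas) hΦ

/-- Almost surely, if finitely many anchors separate the parameters, then the population second moment is nondegenerate. -/
theorem ae_populationGamma_pos (hD : 0 < D) (hΦ_meas : Measurable Φ) (hΦ : ∀ s, ‖Φ s‖ ≤ 1)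
    (ha : ∀ l, Measurable (anchor l)) (hlaw : ∀ l, Pr.map (anchor l) = ν) :
    ∀ᵐ ω ∂Pr, ∀ m, (Separates fun l : Fin m => Φ (anchor l ω)) → 0 < populationGamma Φ ν := by
  obtain ⟨v₀, hv₀, heq, -⟩ := exists_populationGamma_eq (ν := ν) hD hΦ_meas hΦ
  -- If the minimum is `0`, the minimiser `v₀` is orthogonal to `Φ s` for `ν`-almost every `s`. As
  -- `v₀` is deterministic, countably many null sets exclude all anchors at once, contradicting
  -- separation.
  rcases (populationGamma_nonneg (Φ := Φ) (ν := ν)).eq_or_lt with h0 | h0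
  · have hmeas := measurable_inner_encoder hΦ_meas
    have hint : Integrable (fun s => (inner ℝ (Φ s) v₀ : ℝ) ^ 2) ν := by
      simpa only [sq] using integrable_inner_mul_inner hmeas hΦ v₀ v₀
    rw [heq, eq_comm, integral_eq_zero_iff_of_nonneg (fun s => sq_nonneg _) hint] at h0
    have h1 : ∀ᵐ ω ∂Pr, ∀ l, (inner ℝ (Φ (anchor l ω)) v₀ : ℝ) = 0 := by
      refine ae_all_iff.2 fun l => ?_
      rw [← hlaw l] at h0
      filter_upwards [ae_of_ae_map (ha l).aemeasurable h0] with ω hω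
      exact pow_eq_zero_iff two_ne_zero |>.1 hω
    filter_upwards [h1] with ω hω m hsep
    have h2 := hsep v₀ fun l => hω l
    rw [h2] at hv₀
    simp at hv₀
  · exact Eventually.of_forall fun _ _ _ => h0

/-- In the full-rank regime the normalised smallest positive eigenvalue of the anchor Gram matrix
converges almost surely to its population counterpart. -/
theorem ae_tendsto_anchorGamma_div [IsProbabilityMeasure Pr] (hD : 0 < D) (hΦ_meas : Measurable Φ) (hΦ : ∀ s, ‖Φ s‖ ≤ 1)
    (ha : ∀ l, Measurable (anchor l)) (hlaw : ∀ l, Pr.map (anchor l) = ν)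
    (hind : iIndepFun anchor Pr) :
    ∀ᵐ ω ∂Pr, (∃ m, Separates fun l : Fin m => Φ (anchor l ω)) →
      Tendsto (fun m : ℕ => anchorGamma Φ (fun l : Fin m => anchor l ω) / m) atTop
        (𝓝 (populationGamma Φ ν)) := by
  have := nontrivial_euclideanSpace (𝕜 := 𝕜) hD
  obtain ⟨v₀, hv₀, heq, hmin⟩ := exists_populationGamma_eq (ν := ν) hD hΦ_meas hΦ
  filter_upwards [ae_uniform_secondMoment (measurable_inner_encoder hΦ_meas) hΦ ha hlaw hind]
    with ω hω
  rintro ⟨m₀, hm₀⟩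
  obtain ⟨η, hη, hle⟩ := hω
  refine tendsto_iff_norm_sub_tendsto_zero.2 (squeeze_zero' (Eventually.of_forall fun _ =>
    norm_nonneg _) ?_ hη)
  filter_upwards [eventually_ge_atTop m₀] with m hm
  -- Two minima are compared by testing each form at the other's minimiser: `v₀` for the population,
  -- `v₁` for the sample. The uniform error `η m` then bounds their difference on both sides.
  obtain ⟨v₁, hv₁, heq₁, hmin₁⟩ := exists_minPosEigenvalue_eq
    (Separates.mono (y := fun l => Φ (anchor l ω)) hm hm₀)
  rw [Real.norm_eq_abs, anchorGamma_eq, heq₁, heq]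
  have hm0 : (0 : ℝ) ≤ m := Nat.cast_nonneg m
  have h1 := abs_le.1 (hle m v₀ hv₀)
  have h2 := abs_le.1 (hle m v₁ hv₁)
  have h3 := hmin v₁ hv₁
  have h4 := div_le_div_of_nonneg_right (hmin₁ v₀ hv₀) hm0
  unfold frameEnergy at h4 ⊢
  exact abs_le.2 ⟨by linarith, by linarith⟩

/-- Dividing by `m` under the root gives `1 / √(γ m / m + lam / m)`, in which a fixed penalty
disappears. -/
theorem tendsto_sqrt_div_sqrt_add {γ : ℕ → ℝ} {g : ℝ} (hg : 0 < g)
    (h : Tendsto (fun m : ℕ => γ m / m) atTop (𝓝 g)) (lam : ℝ) :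
    Tendsto (fun m : ℕ => √m / √(γ m + lam)) atTop (𝓝 (1 / √g)) := by
  have h1 : Tendsto (fun m : ℕ => γ m / m + lam / m) atTop (𝓝 g) := by
    simpa using h.add (tendsto_const_div_atTop_nhds_zero_nat lam)
  have h2 := (tendsto_const_nhds (x := (1 : ℝ))).div h1.sqrt (Real.sqrt_pos.2 hg).ne'
  refine h2.congr' ?_
  filter_upwards [eventually_gt_atTop 0] with m hm
  have hm' : (0 : ℝ) < m := Nat.cast_pos.2 hm
  simp only [Pi.div_apply]
  rw [← add_div, Real.sqrt_div' _ hm'.le, one_div_div]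

end Asymptotics

end FedQHD

theorem mainTheorem4
    {S A 𝕜 Ω H : Type*} [RCLike 𝕜]
    [TopologicalSpace S] [MeasurableSpace S] [BorelSpace S]
    [Fintype A] [Nonempty A] [MeasurableSpace A] [MeasurableSingletonClass A]
    -- the decision process
    (M : FedQHD.MDP S A)
    -- the clients, their encoders and weights
    {N : ℕ} (D : Fin N → ℕ) (hD : ∀ i, 0 < D i)
    (Φ : ∀ i, S → EuclideanSpace 𝕜 (Fin (D i)))
    (hΦ_meas : ∀ i, Measurable (Φ i)) (hΦ_bdd : ∀ i s, ‖Φ i s‖ ≤ 1)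
    (weight : Fin N → ℝ) (hweight : ∀ i, 0 ≤ weight i) (hweight_sum : ∑ i, weight i = 1)
    -- the common RKHS, with the embeddings of the clients' function classes
    [NormedAddCommGroup H] [InnerProductSpace ℝ H] [CompleteSpace H]
    [TopologicalSpace.SeparableSpace H] [RKHS ℝ H S ℝ]
    (hker_cont : Continuous fun p : S × S => FedQHD.scalarKernel H p.1 p.2)
    (hker_le : ∀ s : S, FedQHD.scalarKernel H s s ≤ 1)
    (J : ∀ i, EuclideanSpace 𝕜 (Fin (D i)) →ₗ[ℝ] H)
    (hJ : ∀ i w s, J i w s = FedQHD.readout (Φ i) w s)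
    -- the optimal action-value function
    (Qstar : A → H) (hQstar : M.IsOptimalQ fun s a => Qstar a s)
    (B : ℝ) (hB : ∀ a, ‖Qstar a‖ ≤ B)
    -- the local state distributions and the feature covariances
    (ν : Fin N → Measure S) [∀ i, IsProbabilityMeasure (ν i)]
    (hcov : ∀ i, (FedQHD.featureCov (Φ i) (ν i)).PosDef)
    -- the i.i.d. anchors
    (νref : Measure S) [IsProbabilityMeasure νref] (hνref : ∀ i, νref ≪ ν i)
    [MeasurableSpace Ω] (Pr : Measure Ω) [IsProbabilityMeasure Pr]
    (anchor : ℕ → Ω → S) (hanchor_meas : ∀ l, Measurable (anchor l))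
    (hanchor_law : ∀ l, Pr.map (anchor l) = νref) (hanchor_indep : iIndepFun anchor Pr)
    -- the oracle parameters, in either sense of the oracle projection
    (μ : Measure (S × A)) [IsProbabilityMeasure μ]
    (What : ∀ i, A → EuclideanSpace 𝕜 (Fin (D i)))
    (hWhat : (∀ i, FedQHD.IsL2Oracle (Φ i) μ (fun s a => Qstar a s) (What i)) ∨
      (∀ i, FedQHD.IsRKHSOracle (J i) Qstar (What i)))
    (i : Fin N) :
    -- every anchor set with `m ≥ dim Dᵢ` and Gram matrix of full rank
    (∀ (m : ℕ) (x : Fin m → S),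
      D i * Module.finrank ℝ 𝕜 ≤ m →
      (FedQHD.anchorGram (Φ i) x).rank = D i * Module.finrank ℝ 𝕜 →
      0 < FedQHD.anchorGamma (Φ i) x ∧
      -- the gap bound at every `λ ≥ 0`
      (∀ lam : ℝ, 0 ≤ lam → ∀ W : A → EuclideanSpace 𝕜 (Fin (D i)),
        FedQHD.IsCompiled (Φ i) x (FedQHD.teacher Φ What weight x) lam W →
        ∀ s a, |FedQHD.fedGap (Φ i) (What i) W s a| ≤
          FedQHD.heterogeneity J Qstar What weight B i
          + √m / √(FedQHD.anchorGamma (Φ i) x + lam)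
              * FedQHD.heterogeneity J Qstar What weight B i
          + lam / (FedQHD.anchorGamma (Φ i) x + lam) * FedQHD.frobNorm (What i)) ∧
      -- the ridge shrinkage term collapses as `λ → 0`
      Tendsto (fun lam : ℝ =>
          lam / (FedQHD.anchorGamma (Φ i) x + lam) * FedQHD.frobNorm (What i))
        (𝓝[>] 0) (𝓝 0) ∧
      -- the gap in the limit `λ → 0`
      (∀ W : ℝ → A → EuclideanSpace 𝕜 (Fin (D i)),
        (∀ lam, 0 < lam →
          FedQHD.IsCompiled (Φ i) x (FedQHD.teacher Φ What weight x) lam (W lam)) →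
        ∀ s a, ∃ δ : ℝ,
          Tendsto (fun lam => FedQHD.fedGap (Φ i) (What i) (W lam) s a) (𝓝[>] 0) (𝓝 δ) ∧
          |δ| ≤ (1 + √m / √(FedQHD.anchorGamma (Φ i) x))
            * FedQHD.heterogeneity J Qstar What weight B i)) ∧
    -- the asymptotics in `m`, almost surely in the full-rank regime
    (∀ᵐ ω ∂Pr,
      (∃ m : ℕ, D i * Module.finrank ℝ 𝕜 ≤ m ∧
        (FedQHD.anchorGram (Φ i) fun l : Fin m => anchor l ω).rank
          = D i * Module.finrank ℝ 𝕜) →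
      0 < FedQHD.populationGamma (Φ i) νref ∧
      Tendsto (fun m : ℕ => FedQHD.anchorGamma (Φ i) (fun l : Fin m => anchor l ω) / m)
        atTop (𝓝 (FedQHD.populationGamma (Φ i) νref)) ∧
      (∀ lam : ℝ, 0 ≤ lam →
        Tendsto (fun m : ℕ =>
            √m / √(FedQHD.anchorGamma (Φ i) (fun l : Fin m => anchor l ω) + lam))
          atTop (𝓝 (1 / √(FedQHD.populationGamma (Φ i) νref)))) ∧
      -- the limiting gap is `O(h̄ᵢ)`, with a constant that does not depend on `m`
      (∀ C : ℝ, 1 + 1 / √(FedQHD.populationGamma (Φ i) νref) < C →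
        ∀ᶠ m : ℕ in atTop,
          ∀ W : ℝ → A → EuclideanSpace 𝕜 (Fin (D i)),
          (∀ lam, 0 < lam →
            FedQHD.IsCompiled (Φ i) (fun l : Fin m => anchor l ω)
              (FedQHD.teacher Φ What weight fun l : Fin m => anchor l ω) lam (W lam)) →
          ∀ s a, ∃ δ : ℝ,
            Tendsto (fun lam => FedQHD.fedGap (Φ i) (What i) (W lam) s a) (𝓝[>] 0) (𝓝 δ) ∧
            |δ| ≤ C * FedQHD.heterogeneity J Qstar What weight B i)) := by
  have hB0 : 0 ≤ B := (norm_nonneg _).trans (hB (Classical.arbitrary A))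
  have hh : 0 ≤ FedQHD.heterogeneity J Qstar What weight B i :=
    FedQHD.heterogeneity_nonneg hweight hB0 i
  have hT : ∀ (m : ℕ) (x : Fin m → S) (l : Fin m) (a : A),
      |FedQHD.readout (Φ i) (What i a) (x l) - FedQHD.teacher Φ What weight x l a|
        ≤ FedQHD.heterogeneity J Qstar What weight B i :=
    fun m x l a => FedQHD.abs_readout_sub_teacher_le hker_le hJ hweight hweight_sum hB0 i x l a
  refine ⟨fun m x _ hrank => ?_, ?_⟩
  · have hsep := FedQHD.separates_of_rank_anchorGram hrank
    have hγ := FedQHD.anchorGamma_pos (hD i) hsep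
    exact ⟨hγ,
      fun lam hlam W hW s a => FedQHD.abs_fedGap_le (hΦ_bdd i) (hD i) hsep hh (hT m x) hlam hW s a,
      FedQHD.tendsto_ridgeShrinkage hγ _,
      fun W hW s a => FedQHD.exists_tendsto_fedGap (hΦ_bdd i) (hD i) hsep hh (hT m x) hW s a⟩
  · filter_upwards [FedQHD.ae_populationGamma_pos (hD i) (hΦ_meas i) (hΦ_bdd i) hanchor_meas
      hanchor_law, FedQHD.ae_tendsto_anchorGamma_div (hD i) (hΦ_meas i) (hΦ_bdd i) hanchor_meas
      hanchor_law hanchor_indep] with ω hpos hlim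
    rintro ⟨m₀, -, hrank⟩
    have hsep := FedQHD.separates_of_rank_anchorGram hrank
    have hg := hpos m₀ hsep
    have hγ := hlim ⟨m₀, hsep⟩
    refine ⟨hg, hγ, fun lam _ => FedQHD.tendsto_sqrt_div_sqrt_add hg hγ lam, fun C hC => ?_⟩
    -- The constant of the limiting gap is the case `lam = 0`; it converges to `1 + 1 / √g`, so it
    -- is eventually below any larger `C`.
    have hsqrt := (FedQHD.tendsto_sqrt_div_sqrt_add hg hγ 0).const_add 1
    filter_upwards [hsqrt.eventually_lt_const hC, eventually_ge_atTop m₀] with m hm hm₀ W hW s a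
    obtain ⟨δ, hδ, hle⟩ := FedQHD.exists_tendsto_fedGap (hΦ_bdd i) (hD i)
      (FedQHD.Separates.mono (y := fun l => Φ i (anchor l ω)) hm₀ hsep) hh (hT m fun l => anchor l ω) hW s a
    rw [add_zero] at hm
    exact ⟨δ, hδ, hle.trans (mul_le_mul_of_nonneg_right hm.le hh)⟩
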